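/- **Setting.** Let $M$ be a compact smooth manifold without boundary of dimension $n\ge 1$, let $g^0$ be a smooth Riemannian metric on $M$ with Riemannian volume $\mathrm{dv}$, and let $f=(f_1,\dots,f_n)$ be a global smooth $g^0$-orthonormal frame of $TM$ (so $M$ is assumed parallelizable). Let $\mathrm{Met}_{\mathrm{dv}}(M)$ be the set of sections of the bundle of positive definite symmetric bilinear forms on the tangent spaces of $M$ whose Riemannian volume is $\mathrm{dv}$. Let $(\psi_j)_{j\ge 0}$ be a complete orthonormal system of $L^2(M,\mathrm{dv})$ of smooth functions with $\Delta_{g^0}\psi_j+\lambda_j\psi_j=0$, $\lambda_0\le\lambda_1\le\cdots$, and let $\beta_j=F(\lambda_j)$, where $F:\mathbb R\to\mathbb R$ is eventually decreasing, $F(t)\to 0$ as $t\to\infty$, and $\sum_j\beta_j^2<\infty$. **The distance.** In the symmetric space $S=\mathrm{SL}_n(\mathbb R)/\mathrm{SO}(n)$, identified with the positive definite matrices of determinant one by $gK\mapsto gg^{T}$ ($K=\mathrm{SO}(n)$), put $d_S(gK,hK)=\|\log a\|$, where $a$ is the diagonal matrix with positive entries, unique up to permutation of its entries, such that $h^{-1}g\in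 KaK$, and $\|\log a\|$ is the Euclidean norm of the vector of logarithms of the diagonal entries of $a$. For $g,h\in \mathrm{Met}_{\mathrm{dv}}(M)$ let $d_x(g_x,h_x)$ be $d_S$ of the matrices of $g_x,h_x$ in the frame $f_x$, and $$\Omega_2^2(g,h)=\int_M d_x(g_x,h_x)^2\,\mathrm{dv}(x).$$ **The random metric.** Let $\xi_j$ be i.i.d. standard Gaussian vectors in $\mathbb R^n$, let $\pi_n$ be the orthogonal projection of $\mathbb R^n$ onto the hyperplane $\sum_i x_i=0$, and let $$b(x)=\sum_{j\ge 1}\pi_n(\xi_j)\,\beta_j\,\psi_j(x)$$ (the limit of the partial sums where they converge, and $0$ elsewhere). Let $k=(k_x)_{x\in M}$ be any, possibly random, field of rotations $k_x\in\mathrm{SO}(n)$, and let $g^1$ be the random metric whose matrix in the frame $f_x$ is $k_x a_x^2 k_x^{-1}$, where $a_x=\mathrm{diag}(e^{b_1(x)},\dots,e^{b_n(x)})$. **Statement.** Almost surely the series for $b(x)$ converges for almost every $x\in M$; $g^1\in\mathrm{Met}_{\mathrm{dv}}(M)$; almost surely $x\mapsto d_x(g^0_x,g^1_x)^2$ is integrable;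 and: 1. $\Omega_2^2(g^0,g^1)$ is a random variable with the law of $\sum_{j\ge 1}\beta_j^2V_j$, where the $V_j$ are i.i.d. $\chi^2_{n-1}$ variables ($\chi^2_0$ being the Dirac mass at $0$) and this series converges almost surely. 2. For every real $t$ with $2t\beta_j^2<1$ for all $j\ge 1$, the variable $\exp(t\,\Omega_2^2(g^0,g^1))$ is integrable and $$E\bigl[\exp(t\,\Omega_2^2(g^0,g^1))\bigr]=\prod_{j\ge 1}(1-2t\beta_j^2)^{-(n-1)/2},$$ where the product converges. 3. For every real $t$, $$E\bigl[\exp(it\,\Omega_2^2(g^0,g^1))\bigr]=\prod_{j\ge 1}(1-2it\beta_j^2)^{-(n-1)/2},$$ with the principal branch of the power, where the product converges. -/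

import Mathlib

open MeasureTheory ProbabilityTheory Filter Topology
open scoped Manifold ContDiff Matrix

noncomputable section

namespace RandomMetric

/-! ### Fields of bilinear forms, volume, Laplacian -/

section Geometry

variable {n : ℕ} {M : Type*} [TopologicalSpace M] [ChartedSpace (EuclideanSpace ℝ (Fin n)) M]

/-- A field `x ↦ g_x` of bilinear forms on the tangent spaces of `M`. -/
abbrev FormField (n : ℕ) (M : Type*) [TopologicalSpace M]
    [ChartedSpace (EuclideanSpace ℝ (Fin n)) M] : Type _ :=
  ∀ x : M, LinearMap.BilinForm ℝ (TangentSpace (𝓡 n) x)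

/-- A smooth Riemannian metric, viewed as a field of bilinear forms. -/
def ofMetric [IsManifold (𝓡 n) ∞ M]
    (g : Bundle.ContMDiffRiemannianMetric (𝓡 n) ∞ (EuclideanSpace ℝ (Fin n))
      (fun x : M => TangentSpace (𝓡 n) x)) : FormField n M :=
  fun x => (g.inner x).toBilinForm

/-- The coordinate vector field `∂_i` of the chart at `x₀`, at the point with coordinates `y`. -/
def coordVector (x₀ : M) (y : EuclideanSpace ℝ (Fin n)) (i : Fin n) :
    TangentSpace (𝓡 n) ((extChartAt (𝓡 n) x₀).symm y) :=
  mfderiv 𝓘(ℝ, EuclideanSpace ℝ (Fin n)) (𝓡 n) (extChartAt (𝓡 n) x₀).symm y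
    (EuclideanSpace.single i (1 : ℝ))

/-- The matrix `(g_ij)` of `g` in the chart at `x₀`, at the point with coordinates `y`. -/
def chartMatrix (g : FormField n M) (x₀ : M) (y : EuclideanSpace ℝ (Fin n)) :
    Matrix (Fin n) (Fin n) ℝ :=
  Matrix.of fun i j => g ((extChartAt (𝓡 n) x₀).symm y) (coordVector x₀ y i) (coordVector x₀ y j)

/-- `dv` is the Riemannian volume of `g`: in each chart it is `√(det g_ij) dy`. -/
def HasVolume [MeasurableSpace M] (g : FormField n M) (dv : Measure M) : Prop :=
  ∀ x₀ : M, (dv.restrict (extChartAt (𝓡 n) x₀).source).map (extChartAt (𝓡 n) x₀) =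
    (volume.restrict (extChartAt (𝓡 n) x₀).target).withDensity
      (fun y => ENNReal.ofReal (Real.sqrt (chartMatrix g x₀ y).det))

/-- `Met_dv(M)`: sections of the bundle of positive definite symmetric bilinear forms on the
tangent spaces, with Riemannian volume `dv`. -/
def MetDv [MeasurableSpace M] (dv : Measure M) : Set (FormField n M) :=
  {g | (∀ x, ∀ v w, g x v w = g x w v) ∧ (∀ x, ∀ v, v ≠ 0 → 0 < g x v v) ∧ HasVolume g dv}

/-- The Laplace-Beltrami operator
`Δ_g u = |g|^{-1/2} ∑_{i,j} ∂_i (|g|^{1/2} g^{ij} ∂_j u)`, in the chart at `x`. -/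
def laplaceBeltrami (g : FormField n M) (u : M → ℝ) (x : M) : ℝ :=
  (Real.sqrt (chartMatrix g x (extChartAt (𝓡 n) x x)).det)⁻¹ *
    ∑ i : Fin n, ∑ j : Fin n,
      fderiv ℝ (fun y : EuclideanSpace ℝ (Fin n) =>
          Real.sqrt (chartMatrix g x y).det * (chartMatrix g x y)⁻¹ i j *
            fderiv ℝ (fun z => u ((extChartAt (𝓡 n) x).symm z)) y (EuclideanSpace.single j (1 : ℝ)))
        (extChartAt (𝓡 n) x x) (EuclideanSpace.single i (1 : ℝ))

/-- `(ψ_j)_{j ≥ 0}` is a complete orthonormal system of `L²(M, dv)` made of smooth Laplace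
eigenfunctions, `Δ_g ψ_j + ev_j ψ_j = 0`, the eigenvalues being in non-decreasing order. -/
structure IsLaplaceEigenbasis [MeasurableSpace M] (g : FormField n M) (dv : Measure M)
    (ψ : ℕ → M → ℝ) (ev : ℕ → ℝ) : Prop where
  smooth : ∀ j, ContMDiff (𝓡 n) 𝓘(ℝ, ℝ) ∞ (ψ j)
  monotone : Monotone ev
  eigen : ∀ j x, laplaceBeltrami g (ψ j) x + ev j * ψ j x = 0
  orthonormal : ∀ i j, ∫ x, ψ i x * ψ j x ∂dv = if i = j then 1 else 0
  complete : ∀ u : M → ℝ, MemLp u 2 dv → (∀ j, ∫ x, u x * ψ j x ∂dv = 0) → u =ᵐ[dv] 0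

/-- A global smooth frame `f = (f_1, …, f_n)` of `TM` which is orthonormal for `g`. -/
structure IsOrthonormalFrame [IsManifold (𝓡 n) ∞ M] (g : FormField n M)
    (f : Fin n → ∀ x : M, TangentSpace (𝓡 n) x) : Prop where
  frame : IsLocalFrameOn (𝓡 n) (EuclideanSpace ℝ (Fin n)) ∞ f Set.univ
  orthonormal : ∀ x i j, g x (f i x) (f j x) = if i = j then 1 else 0

/-- The basis of `T_x M` given by an orthonormal frame. -/
def IsOrthonormalFrame.basis [IsManifold (𝓡 n) ∞ M] {g : FormField n M}
    {f : Fin n → ∀ x : M, TangentSpace (𝓡 n) x} (hf : IsOrthonormalFrame g f) (x : M) :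
    Module.Basis (Fin n) ℝ (TangentSpace (𝓡 n) x) :=
  hf.frame.toBasisAt (Set.mem_univ x)

end Geometry

/-! ### The symmetric space `SL_n(ℝ) / SO(n)` and the distance `Ω₂` -/

/-- For positive definite matrices `P = g gᵀ` and `Q = h hᵀ` of determinant one (the points `gK`
and `hK` of `G/K`, `G = SL_n(ℝ)`, `K = SO(n)`): the class `K h⁻¹ g K` in `K\G/K` is represented by
the diagonal matrix with positive entries `exp (b_i)`, i.e. `P`, `Q` are in relative position
`exp b`. The vector `b` is unique up to a permutation of its coordinates. -/
def IsRelativePosition {n : ℕ} (P Q : Matrix (Fin n) (Fin n) ℝ)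
    (b : EuclideanSpace ℝ (Fin n)) : Prop :=
  ∃ g h : Matrix.SpecialLinearGroup (Fin n) ℝ,
    P = (g : Matrix (Fin n) (Fin n) ℝ) * (g : Matrix (Fin n) (Fin n) ℝ)ᵀ ∧
    Q = (h : Matrix (Fin n) (Fin n) ℝ) * (h : Matrix (Fin n) (Fin n) ℝ)ᵀ ∧
    ∃ k₁ k₂ : Matrix.specialOrthogonalGroup (Fin n) ℝ,
      ((h⁻¹ * g : Matrix.SpecialLinearGroup (Fin n) ℝ) : Matrix (Fin n) (Fin n) ℝ) =
        (k₁ : Matrix (Fin n) (Fin n) ℝ) * Matrix.diagonal (fun i => Real.exp (b i)) *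
          (k₂ : Matrix (Fin n) (Fin n) ℝ)

/-- The invariant distance `d_S(gK, hK) = ‖log a‖` on the space of positive definite matrices of
determinant one, `a` being the relative position. All the vectors `log a` for a given pair are
permutations of one another, so that the infimum is over a set with one element. -/
def symmDist {n : ℕ} (P Q : Matrix (Fin n) (Fin n) ℝ) : ℝ :=
  sInf {r : ℝ | ∃ b : EuclideanSpace ℝ (Fin n), IsRelativePosition P Q b ∧ r = ‖b‖}

section Distance

variable {n : ℕ} {M : Type*} [TopologicalSpace M] [ChartedSpace (EuclideanSpace ℝ (Fin n)) M]
  [IsManifold (𝓡 n) ∞ M]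

/-- The distance `d_x` on the fibre at `x` of `Met_dv(M)`: a frame at `x` which is orthonormal for
the reference metric identifies this fibre with the symmetric space. By invariance of `d_S`
it does not depend on the orthonormal frame. -/
def fibreDist {g₀ : FormField n M} {f : Fin n → ∀ x : M, TangentSpace (𝓡 n) x}
    (hf : IsOrthonormalFrame g₀ f) (g h : FormField n M) (x : M) : ℝ :=
  symmDist (LinearMap.BilinForm.toMatrix (hf.basis x) (g x))
    (LinearMap.BilinForm.toMatrix (hf.basis x) (h x))

/-- `Ω₂²(g, h) = ∫_M d_x(g_x, h_x)² dv(x)`. -/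
def omegaTwoSq [MeasurableSpace M] {g₀ : FormField n M}
    {f : Fin n → ∀ x : M, TangentSpace (𝓡 n) x}
    (hf : IsOrthonormalFrame g₀ f) (dv : Measure M) (g h : FormField n M) : ℝ :=
  ∫ x, fibreDist hf g h x ^ 2 ∂dv

end Distance

/-! ### The random metric -/

/-- The hyperplane `∑ v_i = 0` of `ℝⁿ`. -/
def hyperplane (n : ℕ) : Submodule ℝ (EuclideanSpace ℝ (Fin n)) where
  carrier := {v | ∑ i, v i = 0}
  add_mem' := by
    intro a b ha hb
    simp only [Set.mem_ofPred_eq] at *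
    simp [Finset.sum_add_distrib, ha, hb]
  zero_mem' := by simp
  smul_mem' := by
    intro c a ha
    simp only [Set.mem_ofPred_eq] at *
    simp [← Finset.mul_sum, ha]

section RandomField

variable {n : ℕ} {M Ω : Type*}

/-- The partial sums `∑_{j=1}^N π_n(ξ_j) β_j ψ_j(x)`, where `π_n` is the orthogonal projection onto
the hyperplane `∑ v_i = 0`. -/
def partialField (β : ℕ → ℝ) (ψ : ℕ → M → ℝ) (ξ : ℕ → Ω → EuclideanSpace ℝ (Fin n))
    (N : ℕ) (w : Ω) (x : M) : EuclideanSpace ℝ (Fin n) :=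
  ∑ j ∈ Finset.Icc 1 N, (β j * ψ j x) • (hyperplane n).starProjection (ξ j w)

open Classical in
/-- The Gaussian field `H_x = ∑_{j ≥ 1} π_n(ξ_j) β_j ψ_j(x)`: the limit of the partial sums where
they converge, and `0` elsewhere. -/
def radialField (β : ℕ → ℝ) (ψ : ℕ → M → ℝ) (ξ : ℕ → Ω → EuclideanSpace ℝ (Fin n))
    (w : Ω) (x : M) : EuclideanSpace ℝ (Fin n) :=
  if h : ∃ L, Tendsto (fun N => partialField β ψ ξ N w x) atTop (𝓝 L) then h.choose else 0

/-- The metric `g¹` given by a field `b` of vectors and a field `k` of rotations: in the frame, the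
matrix of `g¹_x` is `k_x a_x² k_x⁻¹`, where `a_x` is diagonal with entries `exp (b_i(x))`. -/
def deformedMetric [TopologicalSpace M] [ChartedSpace (EuclideanSpace ℝ (Fin n)) M]
    [IsManifold (𝓡 n) ∞ M] {g₀ : FormField n M}
    {f : Fin n → ∀ x : M, TangentSpace (𝓡 n) x} (hf : IsOrthonormalFrame g₀ f)
    (b : M → EuclideanSpace ℝ (Fin n)) (k : M → Matrix.specialOrthogonalGroup (Fin n) ℝ) :
    FormField n M :=
  fun x => Matrix.toBilin (hf.basis x)
    ((k x : Matrix (Fin n) (Fin n) ℝ) * Matrix.diagonal (fun i => Real.exp (b x i)) ^ 2 *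
      (k x : Matrix (Fin n) (Fin n) ℝ)⁻¹)

end RandomField

/-- The `χ²` law with `m` degrees of freedom: the law of `∑_{i=1}^m Z_i²` for independent standard
real Gaussians `Z_i` (the Dirac mass at `0` if `m = 0`). -/
def chiSquared (m : ℕ) : Measure ℝ :=
  (Measure.pi fun _ : Fin m => gaussianReal 0 1).map fun z => ∑ i, z i ^ 2

end RandomMetric

end

/-!
In the frame, `g⁰` has matrix `1` and `g¹` has matrix `k exp(2b) k⁻¹` with `∑ b_i = 0`. Hence `g¹`
has determinant one and the volume of `g⁰` (`deformedMetric_mem_metDv`), and the fibre distance is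
`‖b(x)‖`, because the relative position of `1` and `k exp(2b) k⁻¹` is read off the eigenvalues of
the latter (`symmDist_one_conj`). The rotations drop out, and `Ω₂² = ∫ ‖b(x)‖² dv`.

The function `∑_j β_j² ψ_j²` has integral `∑_j β_j²`, so it is finite almost everywhere; at each
such point the series of `b` converges almost surely by martingale convergence
(`ae_exists_tendsto_sum_of_summable_variance`), and Fubini's theorem gives almost sure convergence
almost everywhere (`ae_ae_tendsto_partialField`). Almost surely `∑_j β_j² ‖π_n(ξ_j)‖²` is finite,
the series converges in `L²(dv)` too, and Parseval's identity reads
`∫ ‖b(x)‖² dv = ∑_j β_j² ‖π_n(ξ_j)‖²` (`integrable_and_integral_norm_sq_of_orthonormal`).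

The variables `‖π_n(ξ_j)‖²` are independent with the `χ²` law of `n - 1` degrees of freedom
(`hasLaw_norm_sq_starProjection_hyperplane`), which gives the law of `Ω₂²`. The exponential moments
come from the Gaussian integral with a complex parameter (`integral_cexp_mul_chiSquared`): finite
partial sums have the finite products as moments, and dominated convergence along the net of finite
sets of indices gives the unordered infinite product (`hasProd_integral_cexp_mul_tsum`). For
`t > 0` the dominating function `exp (t ∑_j β_j² V_j)` is integrable by Fatou's lemma, the finite
products being bounded (`exists_prod_rpow_le`).
-/

namespace RandomMetric

/-! ### The distance from the base point of the symmetric space -/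

section SymmetricSpace

variable {n : ℕ}

lemma coe_mul_transpose_specialOrthogonal (k : Matrix.specialOrthogonalGroup (Fin n) ℝ) :
    (k : Matrix (Fin n) (Fin n) ℝ) * (k : Matrix (Fin n) (Fin n) ℝ)ᵀ = 1 :=
  (Matrix.mem_orthogonalGroup_iff _ _).1 (Matrix.mem_specialOrthogonalGroup_iff.1 k.2).1

lemma transpose_mul_coe_specialOrthogonal (k : Matrix.specialOrthogonalGroup (Fin n) ℝ) :
    (k : Matrix (Fin n) (Fin n) ℝ)ᵀ * (k : Matrix (Fin n) (Fin n) ℝ) = 1 :=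
  mul_eq_one_comm.1 (coe_mul_transpose_specialOrthogonal k)

lemma inv_coe_specialOrthogonal (k : Matrix.specialOrthogonalGroup (Fin n) ℝ) :
    (k : Matrix (Fin n) (Fin n) ℝ)⁻¹ = (k : Matrix (Fin n) (Fin n) ℝ)ᵀ :=
  Matrix.inv_eq_right_inv (coe_mul_transpose_specialOrthogonal k)

lemma det_coe_specialOrthogonal (k : Matrix.specialOrthogonalGroup (Fin n) ℝ) :
    (k : Matrix (Fin n) (Fin n) ℝ).det = 1 :=
  (Matrix.mem_specialOrthogonalGroup_iff.1 k.2).2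

lemma diagonal_exp_mul_diagonal_exp_neg (b : Fin n → ℝ) :
    Matrix.diagonal (fun i => Real.exp (b i)) * Matrix.diagonal (fun i => Real.exp (-b i)) = 1 := by
  rw [Matrix.diagonal_mul_diagonal, ← Matrix.diagonal_one]
  congr 1
  ext i
  rw [← Real.exp_add, add_neg_cancel, Real.exp_zero]

lemma diagonal_exp_sq (b : Fin n → ℝ) :
    Matrix.diagonal (fun i => Real.exp (b i)) ^ 2 = Matrix.diagonal (fun i => Real.exp (2 * b i)) := by
  rw [Matrix.diagonal_pow]
  congr 1
  ext i
  rw [Pi.pow_apply, ← Real.exp_nat_mul]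
  norm_num

/-- Conjugate diagonal matrices with entries `exp (2 b_i)` and `exp (2 c_i)` have the same
eigenvalues with multiplicities, hence `b` and `c` have the same norm. -/
lemma norm_eq_of_charpoly_diagonal_exp_eq {b c : EuclideanSpace ℝ (Fin n)}
    (h : (Matrix.diagonal fun i => Real.exp (2 * b i)).charpoly =
      (Matrix.diagonal fun i => Real.exp (2 * c i)).charpoly) : ‖b‖ = ‖c‖ := by
  have hm : ∀ u : Fin n → ℝ, (∏ i, (Polynomial.X - Polynomial.C (u i))).roots
      = Finset.univ.val.map u := by
    intro u
    have := Polynomial.roots_multiset_prod_X_sub_C (Finset.univ.val.map u)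
    rwa [Multiset.map_map] at this
  have hr := congrArg (fun p => (p.roots.map fun x => (Real.log x / 2) ^ 2).sum) h
  simp only [Matrix.charpoly_diagonal, hm, Multiset.map_map, Function.comp_def, Real.log_exp,
    mul_div_cancel_left₀ _ (two_ne_zero' ℝ)] at hr
  rw [EuclideanSpace.norm_eq, EuclideanSpace.norm_eq]
  simp only [Real.norm_eq_abs, sq_abs]
  exact congrArg Real.sqrt hr

/-- Two relative positions of the base point and of `k exp(2b) k⁻¹` have the same norm. -/
lemma IsRelativePosition.norm_eq {b c : EuclideanSpace ℝ (Fin n)}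
    {k : Matrix.specialOrthogonalGroup (Fin n) ℝ}
    (h : IsRelativePosition 1 ((k : Matrix (Fin n) (Fin n) ℝ) *
      Matrix.diagonal (fun i => Real.exp (b i)) ^ 2 * (k : Matrix (Fin n) (Fin n) ℝ)⁻¹) c) :
    ‖c‖ = ‖b‖ := by
  obtain ⟨g, q, hg, hq, k₁, k₂, hk⟩ := h
  have hgq : (q : Matrix (Fin n) (Fin n) ℝ) * ((k₁ : Matrix (Fin n) (Fin n) ℝ) *
      Matrix.diagonal (fun i => Real.exp (c i)) * (k₂ : Matrix (Fin n) (Fin n) ℝ)) = g := by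
    rw [← hk, ← Matrix.SpecialLinearGroup.coe_mul, mul_inv_cancel_left]
  set G : Matrix (Fin n) (Fin n) ℝ := ↑g
  set Q : Matrix (Fin n) (Fin n) ℝ := ↑q
  set K₁ : Matrix (Fin n) (Fin n) ℝ := ↑k₁
  set K₂ : Matrix (Fin n) (Fin n) ℝ := ↑k₂
  have h1 : K₁ * K₁ᵀ = 1 := coe_mul_transpose_specialOrthogonal k₁
  have h1' : K₁ᵀ * K₁ = 1 := transpose_mul_coe_specialOrthogonal k₁
  have h2 : K₂ * K₂ᵀ = 1 := coe_mul_transpose_specialOrthogonal k₂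
  have hQ : Q = G * K₂ᵀ * Matrix.diagonal (fun i => Real.exp (-c i)) * K₁ᵀ := by
    rw [← hgq]
    calc Q = Q * (K₁ * K₁ᵀ) := by rw [h1, mul_one]
      _ = Q * (K₁ * (Matrix.diagonal (fun i => Real.exp (c i)) *
            Matrix.diagonal (fun i => Real.exp (-c i))) * K₁ᵀ) := by
          rw [diagonal_exp_mul_diagonal_exp_neg, mul_one]
      _ = Q * (K₁ * (Matrix.diagonal (fun i => Real.exp (c i)) * (K₂ * K₂ᵀ) *
            Matrix.diagonal (fun i => Real.exp (-c i))) * K₁ᵀ) := by rw [h2, mul_one]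
      _ = _ := by simp only [mul_assoc]
  -- `Q Qᵀ` is conjugate to `exp(-2c)` by the orthogonal matrix `G K₂ᵀ`
  have hQQ : Q * Qᵀ = (G * K₂ᵀ) * Matrix.diagonal (fun i => Real.exp (2 * (-c) i)) *
      (G * K₂ᵀ)ᵀ := by
    have := diagonal_exp_sq (fun i => -c i)
    simp only [PiLp.neg_apply]
    rw [← this, hQ, sq]
    simp only [Matrix.transpose_mul, Matrix.transpose_transpose, Matrix.diagonal_transpose]
    calc _ = G * K₂ᵀ * Matrix.diagonal (fun i => Real.exp (-c i)) * (K₁ᵀ * K₁) *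
          (Matrix.diagonal (fun i => Real.exp (-c i)) * (K₂ * Gᵀ)) := by simp only [mul_assoc]
      _ = _ := by rw [h1', mul_one]; simp only [mul_assoc]
  have hO : (G * K₂ᵀ) * (G * K₂ᵀ)ᵀ = 1 := by
    rw [Matrix.transpose_mul, Matrix.transpose_transpose, mul_assoc, ← mul_assoc K₂ᵀ,
      transpose_mul_coe_specialOrthogonal k₂, one_mul, ← hg]
  have key : ∀ (A D : Matrix (Fin n) (Fin n) ℝ), A * Aᵀ = 1 →
      (A * D * Aᵀ).charpoly = D.charpoly := by
    intro A D hA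
    rw [Matrix.charpoly_mul_comm, ← mul_assoc, mul_eq_one_comm.1 hA, one_mul]
  rw [← norm_neg]
  apply norm_eq_of_charpoly_diagonal_exp_eq
  rw [← key _ _ hO, ← hQQ, ← hq, inv_coe_specialOrthogonal,
    key _ _ (coe_mul_transpose_specialOrthogonal k), diagonal_exp_sq]

lemma det_diagonal_exp (b : Fin n → ℝ) (hb : ∑ i, b i = 0) :
    (Matrix.diagonal fun i => Real.exp (b i)).det = 1 := by
  rw [Matrix.det_diagonal, ← Real.exp_sum, hb, Real.exp_zero]

/-- The representatives `1` of the base point and `k exp(b)` of `k exp(2b) k⁻¹` exhibit `-b` as a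
relative position; the inverse `h⁻¹ g` accounts for the sign. -/
lemma isRelativePosition_one_neg {b : EuclideanSpace ℝ (Fin n)} (hb : ∑ i, b i = 0)
    (k : Matrix.specialOrthogonalGroup (Fin n) ℝ) :
    IsRelativePosition 1 ((k : Matrix (Fin n) (Fin n) ℝ) *
      Matrix.diagonal (fun i => Real.exp (b i)) ^ 2 * (k : Matrix (Fin n) (Fin n) ℝ)⁻¹) (-b) := by
  have hdet : ((k : Matrix (Fin n) (Fin n) ℝ) *
      Matrix.diagonal (fun i => Real.exp (b i))).det = 1 := by
    rw [Matrix.det_mul, det_coe_specialOrthogonal, det_diagonal_exp _ hb, one_mul]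
  refine ⟨1, ⟨_, hdet⟩, by simp, ?_, 1, k⁻¹, ?_⟩
  · rw [inv_coe_specialOrthogonal]
    simp only [Matrix.transpose_mul, Matrix.diagonal_transpose, sq, mul_assoc]
  · rw [mul_one]
    have hk : ((k⁻¹ : Matrix.specialOrthogonalGroup (Fin n) ℝ) : Matrix (Fin n) (Fin n) ℝ) =
        (k : Matrix (Fin n) (Fin n) ℝ)ᵀ := rfl
    have hinv : ∀ (q : Matrix.SpecialLinearGroup (Fin n) ℝ) (A : Matrix (Fin n) (Fin n) ℝ),
        (q : Matrix (Fin n) (Fin n) ℝ) * A = 1 →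
        ((q⁻¹ : Matrix.SpecialLinearGroup (Fin n) ℝ) : Matrix (Fin n) (Fin n) ℝ) = A := by
      intro q A hA
      calc ((q⁻¹ : Matrix.SpecialLinearGroup (Fin n) ℝ) : Matrix (Fin n) (Fin n) ℝ)
          = (q⁻¹ : Matrix.SpecialLinearGroup (Fin n) ℝ) * (q * A) := by rw [hA, mul_one]
        _ = ((q⁻¹ * q : Matrix.SpecialLinearGroup (Fin n) ℝ) : Matrix (Fin n) (Fin n) ℝ) * A := by
          rw [Matrix.SpecialLinearGroup.coe_mul, mul_assoc]
        _ = A := by rw [inv_mul_cancel, Matrix.SpecialLinearGroup.coe_one, one_mul]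
    apply hinv
    rw [hk]
    change ((k : Matrix (Fin n) (Fin n) ℝ) * Matrix.diagonal (fun i => Real.exp (b i))) *
      ((1 : Matrix (Fin n) (Fin n) ℝ) * Matrix.diagonal (fun i => Real.exp (-b i)) *
        (k : Matrix (Fin n) (Fin n) ℝ)ᵀ) = 1
    rw [one_mul, mul_assoc, ← mul_assoc (Matrix.diagonal _), diagonal_exp_mul_diagonal_exp_neg,
      one_mul, coe_mul_transpose_specialOrthogonal]

/-- The point `k exp(2b) k⁻¹` of the symmetric space is at distance `‖b‖` from the base point. -/
lemma symmDist_one_conj {b : EuclideanSpace ℝ (Fin n)} (hb : ∑ i, b i = 0)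
    (k : Matrix.specialOrthogonalGroup (Fin n) ℝ) :
    symmDist 1 ((k : Matrix (Fin n) (Fin n) ℝ) *
      Matrix.diagonal (fun i => Real.exp (b i)) ^ 2 * (k : Matrix (Fin n) (Fin n) ℝ)⁻¹) = ‖b‖ := by
  have : {r : ℝ | ∃ c : EuclideanSpace ℝ (Fin n), IsRelativePosition 1
      ((k : Matrix (Fin n) (Fin n) ℝ) * Matrix.diagonal (fun i => Real.exp (b i)) ^ 2 *
        (k : Matrix (Fin n) (Fin n) ℝ)⁻¹) c ∧ r = ‖c‖} = {‖b‖} := by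
    ext r
    constructor
    · rintro ⟨c, hc, rfl⟩
      exact hc.norm_eq
    · rintro rfl
      exact ⟨-b, isRelativePosition_one_neg hb k, (norm_neg b).symm⟩
  rw [symmDist, this, csInf_singleton]

end SymmetricSpace

/-! ### The deformed metric -/

section Deformation

variable {n : ℕ} {M : Type*} [TopologicalSpace M] [ChartedSpace (EuclideanSpace ℝ (Fin n)) M]
  [IsManifold (𝓡 n) ∞ M]

lemma of_toBilin_apply {V : Type*} [AddCommGroup V] [Module ℝ V]
    (e : Module.Basis (Fin n) ℝ V) (A : Matrix (Fin n) (Fin n) ℝ) (v : Fin n → V) :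
    (Matrix.of fun i j => Matrix.toBilin e A (v i) (v j)) = (e.toMatrix v)ᵀ * A * e.toMatrix v := by
  ext i j
  simp only [Matrix.of_apply, Matrix.toBilin_apply, Matrix.mul_apply, Matrix.transpose_apply,
    Module.Basis.toMatrix_apply, Finset.sum_mul]
  exact Finset.sum_comm

lemma toMatrix_orthonormalFrame {g : FormField n M} {f : Fin n → ∀ x : M, TangentSpace (𝓡 n) x}
    (hf : IsOrthonormalFrame g f) (x : M) :
    LinearMap.BilinForm.toMatrix (hf.basis x) (g x) = 1 := by
  ext i j
  have h : ∀ i, hf.basis x i = f i x := fun i => by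
    simp [IsOrthonormalFrame.basis]
  rw [LinearMap.BilinForm.toMatrix_apply, h, h, hf.orthonormal, Matrix.one_apply]

lemma toMatrix_deformedMetric {g : FormField n M} {f : Fin n → ∀ x : M, TangentSpace (𝓡 n) x}
    (hf : IsOrthonormalFrame g f) (b : M → EuclideanSpace ℝ (Fin n))
    (k : M → Matrix.specialOrthogonalGroup (Fin n) ℝ) (x : M) :
    LinearMap.BilinForm.toMatrix (hf.basis x) (deformedMetric hf b k x) =
      (k x : Matrix (Fin n) (Fin n) ℝ) * Matrix.diagonal (fun i => Real.exp (b x i)) ^ 2 *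
        (k x : Matrix (Fin n) (Fin n) ℝ)⁻¹ :=
  LinearMap.BilinForm.toMatrix_toBilin _ _

/-- The metric deformed by `b` is at distance `‖b x‖` from the reference metric in the fibre
at `x`, whatever the field of rotations. -/
lemma fibreDist_deformedMetric {g : FormField n M} {f : Fin n → ∀ x : M, TangentSpace (𝓡 n) x}
    (hf : IsOrthonormalFrame g f) (b : M → EuclideanSpace ℝ (Fin n))
    (hb : ∀ x, ∑ i, b x i = 0)
    (k : M → Matrix.specialOrthogonalGroup (Fin n) ℝ) (x : M) :
    fibreDist hf g (deformedMetric hf b k) x = ‖b x‖ := by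
  rw [fibreDist, toMatrix_orthonormalFrame, toMatrix_deformedMetric, symmDist_one_conj (hb x)]

lemma det_chartMatrix {g : FormField n M} {f : Fin n → ∀ x : M, TangentSpace (𝓡 n) x}
    (hf : IsOrthonormalFrame g f) (g' : FormField n M) (x₀ : M) (y : EuclideanSpace ℝ (Fin n)) :
    (chartMatrix g' x₀ y).det =
      (LinearMap.BilinForm.toMatrix (hf.basis ((extChartAt (𝓡 n) x₀).symm y))
        (g' ((extChartAt (𝓡 n) x₀).symm y))).det *
      ((hf.basis ((extChartAt (𝓡 n) x₀).symm y)).toMatrix (coordVector x₀ y)).det ^ 2 := by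
  have h := of_toBilin_apply (hf.basis ((extChartAt (𝓡 n) x₀).symm y))
    (LinearMap.BilinForm.toMatrix (hf.basis ((extChartAt (𝓡 n) x₀).symm y))
      (g' ((extChartAt (𝓡 n) x₀).symm y))) (coordVector x₀ y)
  rw [Matrix.toBilin_toMatrix] at h
  rw [chartMatrix, h, Matrix.det_mul, Matrix.det_mul, Matrix.det_transpose]
  ring

lemma deformedMetric_apply {g : FormField n M} {f : Fin n → ∀ x : M, TangentSpace (𝓡 n) x}
    (hf : IsOrthonormalFrame g f) (b : M → EuclideanSpace ℝ (Fin n))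
    (k : M → Matrix.specialOrthogonalGroup (Fin n) ℝ) (x : M) (v w : TangentSpace (𝓡 n) x) :
    deformedMetric hf b k x v w = ∑ i, Real.exp (2 * b x i) *
      ((k x : Matrix (Fin n) (Fin n) ℝ)ᵀ *ᵥ (hf.basis x).repr v) i *
      ((k x : Matrix (Fin n) (Fin n) ℝ)ᵀ *ᵥ (hf.basis x).repr w) i := by
  rw [deformedMetric, inv_coe_specialOrthogonal, diagonal_exp_sq, Matrix.toBilin_apply]
  set K : Matrix (Fin n) (Fin n) ℝ := (k x : Matrix (Fin n) (Fin n) ℝ)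
  have h : ∀ (A : Matrix (Fin n) (Fin n) ℝ) (p q : Fin n → ℝ),
      ∑ i, ∑ j, p i * A i j * q j = p ⬝ᵥ A *ᵥ q := by
    intro A p q
    simp only [dotProduct, Matrix.mulVec, Finset.mul_sum, mul_assoc]
  rw [h, ← Matrix.mulVec_mulVec, ← Matrix.mulVec_mulVec, Matrix.dotProduct_mulVec,
    ← Matrix.mulVec_transpose]
  simp only [dotProduct, Matrix.mulVec_diagonal]
  exact Finset.sum_congr rfl fun i _ => by ring

/-- A deformation by a field of vectors with vanishing coordinate sums is a positive definite
metric with the volume of the reference metric: its determinant in the frame is one. -/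
lemma deformedMetric_mem_metDv [MeasurableSpace M] {dv : Measure M} {g : FormField n M}
    (hg : HasVolume g dv) {f : Fin n → ∀ x : M, TangentSpace (𝓡 n) x}
    (hf : IsOrthonormalFrame g f) (b : M → EuclideanSpace ℝ (Fin n))
    (hb : ∀ x, ∑ i, b x i = 0) (k : M → Matrix.specialOrthogonalGroup (Fin n) ℝ) :
    deformedMetric hf b k ∈ MetDv dv := by
  refine ⟨fun x v w => ?_, fun x v hv => ?_, fun x₀ => ?_⟩
  · rw [deformedMetric_apply, deformedMetric_apply]
    exact Finset.sum_congr rfl fun i _ => by ring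
  · rw [deformedMetric_apply]
    have hne : (k x : Matrix (Fin n) (Fin n) ℝ)ᵀ *ᵥ (hf.basis x).repr v ≠ 0 := by
      intro h0
      apply hv
      have h1 := congrArg ((k x : Matrix (Fin n) (Fin n) ℝ) *ᵥ ·) h0
      simp only [Matrix.mulVec_mulVec, coe_mul_transpose_specialOrthogonal, Matrix.one_mulVec,
        Matrix.mulVec_zero] at h1
      exact (hf.basis x).repr.map_eq_zero_iff.1 (DFunLike.coe_injective h1)
    obtain ⟨i, hi⟩ := Function.ne_iff.1 hne
    refine Finset.sum_pos' (fun j _ => ?_) ⟨i, Finset.mem_univ i, ?_⟩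
    · rw [mul_assoc]
      exact mul_nonneg (Real.exp_pos _).le (mul_self_nonneg _)
    · rw [mul_assoc]
      exact mul_pos (Real.exp_pos _) (mul_self_pos.2 hi)
  · rw [hg x₀]
    congr 1
    ext y
    rw [det_chartMatrix hf g, det_chartMatrix hf (deformedMetric hf b k),
      toMatrix_orthonormalFrame, toMatrix_deformedMetric, Matrix.det_mul, Matrix.det_mul,
      inv_coe_specialOrthogonal, Matrix.det_transpose, det_coe_specialOrthogonal, Matrix.det_pow,
      det_diagonal_exp _ (hb _)]
    simp

end Deformation

/-! ### The chi-squared law -/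

section ChiSquared

/-- The exponential moment of the square of a standard Gaussian. -/
lemma integral_cexp_mul_sq_gaussianReal {z : ℂ} (hz : z.re < 1 / 2) :
    ∫ x, Complex.exp (z * (x : ℂ) ^ 2) ∂(gaussianReal 0 1) = (1 - 2 * z) ^ (-(1 / 2) : ℂ) := by
  rw [integral_gaussianReal_eq_integral_smul one_ne_zero]
  have hre : 0 < (1 - 2 * z).re := by simp; linarith
  have hne : (1 - 2 * z) ≠ 0 := fun h => by simp [h] at hre
  have hb : 0 < (1 / 2 - z).re := by simp; linarith
  have h1 : ∀ x : ℝ, gaussianPDFReal 0 1 x • Complex.exp (z * (x : ℂ) ^ 2) =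
      ((Real.sqrt (2 * Real.pi))⁻¹ : ℝ) * Complex.exp (-(1 / 2 - z) * (x : ℂ) ^ 2) := by
    intro x
    rw [gaussianPDFReal, Complex.real_smul]
    push_cast
    rw [mul_assoc, ← Complex.exp_add]
    congr 3
    · simp
    · ring
  simp_rw [h1]
  rw [integral_const_mul, integral_gaussian_complex hb]
  have hpi : (Real.pi : ℂ) / (1 / 2 - z) = ((2 * Real.pi : ℝ) : ℂ) * (1 - 2 * z)⁻¹ := by
    have : (1 / 2 - z) = (1 - 2 * z) / 2 := by ring
    rw [this]
    push_cast
    field_simp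
  have hlog : ((2 * Real.pi : ℝ) : ℂ) ≠ 0 := by exact_mod_cast Real.two_pi_pos.ne'
  have harg : (1 - 2 * z).arg ≠ Real.pi := fun h =>
    absurd (Complex.arg_eq_pi_iff.1 h).1 (not_lt.2 hre.le)
  rw [hpi, Complex.cpow_def_of_ne_zero (mul_ne_zero hlog (inv_ne_zero hne)),
    Complex.log_ofReal_mul Real.two_pi_pos (inv_ne_zero hne), add_mul, Complex.exp_add,
    Complex.log_inv _ harg, Complex.cpow_def_of_ne_zero hne, ← mul_assoc]
  have hsqrt : Complex.exp ((Real.log (2 * Real.pi) : ℂ) * (1 / 2)) =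
      (Real.sqrt (2 * Real.pi) : ℝ) := by
    rw [Real.sqrt_eq_rpow, Real.rpow_def_of_pos Real.two_pi_pos]
    push_cast
    rfl
  rw [hsqrt, ← Complex.ofReal_mul, inv_mul_cancel₀ (Real.sqrt_pos.2 Real.two_pi_pos).ne',
    Complex.ofReal_one, one_mul]
  congr 1
  ring

variable (m : ℕ)

lemma measurable_sum_sq : Measurable fun z : Fin m → ℝ => ∑ i, z i ^ 2 := by fun_prop

lemma ae_nonneg_chiSquared : ∀ᵐ x ∂(chiSquared m), 0 ≤ x := by
  rw [chiSquared, ae_map_iff (measurable_sum_sq m).aemeasurable measurableSet_Ici]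
  exact Eventually.of_forall fun z => Finset.sum_nonneg fun i _ => sq_nonneg _

/-- The exponential moments of the `χ²` law, real and imaginary arguments alike. -/
lemma integral_cexp_mul_chiSquared {z : ℂ} (hz : z.re < 1 / 2) :
    ∫ x, Complex.exp (z * (x : ℂ)) ∂(chiSquared m) = (1 - 2 * z) ^ (-((m : ℂ) / 2)) := by
  rw [chiSquared, integral_map (measurable_sum_sq m).aemeasurable (by fun_prop)]
  have h : ∀ x : Fin m → ℝ, Complex.exp (z * ((∑ i, x i ^ 2 : ℝ) : ℂ)) =
      ∏ i, Complex.exp (z * (x i : ℂ) ^ 2) := by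
    intro x
    rw [← Complex.exp_sum]
    push_cast
    rw [Finset.mul_sum]
  simp_rw [h]
  rw [integral_fintype_prod_eq_prod (fun (_ : Fin m) (y : ℝ) => Complex.exp (z * (y : ℂ) ^ 2)),
    Finset.prod_const, integral_cexp_mul_sq_gaussianReal hz, Finset.card_univ, Fintype.card_fin,
    ← Complex.cpow_nat_mul]
  congr 1
  ring

lemma mgf_chiSquared {s : ℝ} (hs : s < 1 / 2) :
    ∫ x, Real.exp (s * x) ∂(chiSquared m) = (1 - 2 * s) ^ (-((m : ℝ) / 2)) := by
  have h := integral_cexp_mul_chiSquared m (z := (s : ℂ)) (by simpa using hs)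
  rw [← Complex.ofReal_inj, ← integral_complex_ofReal, Complex.ofReal_cpow (by linarith)]
  push_cast
  exact h

lemma integrable_exp_mul_chiSquared {s : ℝ} (hs : s < 1 / 2) :
    Integrable (fun x => Real.exp (s * x)) (chiSquared m) := by
  refine Integrable.of_integral_ne_zero ?_
  rw [mgf_chiSquared m hs]
  exact (Real.rpow_pos_of_pos (by linarith) _).ne'

lemma integrable_id_chiSquared : Integrable (fun x : ℝ => x) (chiSquared m) := by
  refine ((integrable_exp_mul_chiSquared m (s := 1 / 4) (by norm_num)).const_mul 4).mono'
    (by fun_prop) ?_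
  filter_upwards [ae_nonneg_chiSquared m] with x hx
  rw [Real.norm_of_nonneg hx]
  linarith [Real.add_one_le_exp (1 / 4 * x)]

/-! ### The projected Gaussian vector -/

/-- The orthogonal projection of a standard Gaussian vector onto a subspace is a standard Gaussian
vector of this subspace. -/
lemma map_orthogonalProjectionOnto_stdGaussian {E : Type*} [NormedAddCommGroup E]
    [InnerProductSpace ℝ E] [FiniteDimensional ℝ E] [MeasurableSpace E] [BorelSpace E]
    (U : Submodule ℝ E) :
    (stdGaussian E).map U.orthogonalProjectionOnto = stdGaussian U := by
  apply Measure.ext_of_charFunDual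
  ext L
  rw [charFunDual_map, charFunDual_stdGaussian, charFunDual_stdGaussian]
  have h : ‖L.comp U.orthogonalProjectionOnto‖ = ‖L‖ := by
    apply le_antisymm
    · refine (L.opNorm_comp_le _).trans ?_
      exact mul_le_of_le_one_right (norm_nonneg _) U.orthogonalProjectionOnto_norm_le
    · refine L.opNorm_le_bound (norm_nonneg _) fun u => ?_
      have := (L.comp U.orthogonalProjectionOnto).le_opNorm (u : E)
      simpa using this
  rw [h]

/-- The squared norm of the projection of a standard Gaussian vector onto a subspace is a sum of
squares of independent standard Gaussian coordinates, one for each dimension of the subspace. -/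
lemma map_norm_sq_starProjection_stdGaussian {E : Type*} [NormedAddCommGroup E]
    [InnerProductSpace ℝ E] [FiniteDimensional ℝ E] [MeasurableSpace E] [BorelSpace E]
    (U : Submodule ℝ E) :
    (stdGaussian E).map (fun v => ‖U.starProjection v‖ ^ 2) = chiSquared (Module.finrank ℝ U) := by
  have h : (fun v => ‖U.starProjection v‖ ^ 2) =
      (fun u : U => ‖u‖ ^ 2) ∘ U.orthogonalProjectionOnto := by
    ext v
    rfl
  rw [h, ← Measure.map_map (by fun_prop) (by fun_prop), map_orthogonalProjectionOnto_stdGaussian,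
    stdGaussian, Measure.map_map (by fun_prop) (by fun_prop), chiSquared]
  congr 1
  ext x
  rw [Function.comp_apply, ← (stdOrthonormalBasis ℝ U).sum_sq_norm_inner_right]
  refine Finset.sum_congr rfl fun i _ => ?_
  rw [(stdOrthonormalBasis ℝ U).orthonormal.inner_right_fintype, Real.norm_eq_abs, sq_abs]

lemma finrank_hyperplane {n : ℕ} (hn : 1 ≤ n) : Module.finrank ℝ (hyperplane n) = n - 1 := by
  obtain ⟨m, rfl⟩ := Nat.exists_eq_add_of_le' hn
  have h : hyperplane (m + 1) =
      (Submodule.span ℝ {(WithLp.toLp 2 fun _ => 1 : EuclideanSpace ℝ (Fin (m + 1)))})ᗮ := by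
    ext v
    rw [Submodule.mem_orthogonal_singleton_iff_inner_right]
    change ∑ i, v i = 0 ↔ _
    simp [PiLp.inner_apply]
  have hne : (WithLp.toLp 2 fun _ => 1 : EuclideanSpace ℝ (Fin (m + 1))) ≠ 0 := fun h0 => by
    simpa using congrArg (fun v : EuclideanSpace ℝ (Fin (m + 1)) => v 0) h0
  have : Fact (Module.finrank ℝ (EuclideanSpace ℝ (Fin (m + 1))) = m + 1) := ⟨by simp⟩
  rw [h, Submodule.finrank_orthogonal_span_singleton (n := m) hne, Nat.add_sub_cancel]

/-- The projection onto the hyperplane of a standard Gaussian vector has a `χ²` squared norm. -/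
lemma hasLaw_norm_sq_starProjection_hyperplane {n : ℕ} (hn : 1 ≤ n) {Ω : Type*}
    [MeasurableSpace Ω] {P : Measure Ω} {ξ : Ω → EuclideanSpace ℝ (Fin n)}
    (hξ : HasLaw ξ (stdGaussian (EuclideanSpace ℝ (Fin n))) P) :
    HasLaw (fun w => ‖(hyperplane n).starProjection (ξ w)‖ ^ 2) (chiSquared (n - 1)) P := by
  have h : HasLaw (fun v => ‖(hyperplane n).starProjection v‖ ^ 2) (chiSquared (n - 1))
      (stdGaussian (EuclideanSpace ℝ (Fin n))) :=
    ⟨by fun_prop, by rw [map_norm_sq_starProjection_stdGaussian, finrank_hyperplane hn]⟩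
  exact h.fun_comp hξ

end ChiSquared

/-! ### Weighted series of independent chi-squared variables -/

section Series

variable {Ω : Type*} [MeasurableSpace Ω] {P : Measure Ω} {m : ℕ}
  {V : ℕ → Ω → ℝ} {a : ℕ → ℝ}

lemma ae_nonneg_of_hasLaw_chiSquared (hV : ∀ j, HasLaw (V j) (chiSquared m) P) :
    ∀ᵐ w ∂P, ∀ j, 0 ≤ V j w :=
  ae_all_iff.2 fun j => ((hV j).ae_iff measurableSet_Ici.mem).2 (ae_nonneg_chiSquared m)

/-- The series converges almost surely, its terms being nonnegative with summable expectations. -/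
lemma ae_summable_mul_chiSquared (hV : ∀ j, HasLaw (V j) (chiSquared m) P)
    (ha0 : ∀ j, 0 ≤ a j) (ha : Summable a) : ∀ᵐ w ∂P, Summable fun j => a j * V j w := by
  have hint : ∀ j, Integrable (fun w => V j w) P := fun j => by
    have := integrable_id_chiSquared m
    rw [← (hV j).map_eq] at this
    exact this.comp_aemeasurable (hV j).aemeasurable
  have hE : ∀ j, ∫⁻ w, ‖a j * V j w‖ₑ ∂P =
      ENNReal.ofReal (a j) * ∫⁻ x, ‖x‖ₑ ∂(chiSquared m) := by
    intro j
    simp_rw [enorm_mul]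
    rw [lintegral_const_mul'' _ (hV j).aemeasurable.enorm, Real.enorm_of_nonneg (ha0 j),
      ← (hV j).lintegral_comp (by fun_prop)]
  have hsum : ∫⁻ w, ∑' j, ‖a j * V j w‖ₑ ∂P ≠ ⊤ := by
    rw [lintegral_tsum fun j => ((hV j).aemeasurable.const_mul _).enorm]
    simp_rw [hE]
    rw [ENNReal.tsum_mul_right]
    exact ENNReal.mul_ne_top ha.tsum_ofReal_ne_top (integrable_id_chiSquared m).2.ne
  filter_upwards [ae_lt_top' (AEMeasurable.tsum
    fun j => ((hV j).aemeasurable.const_mul _).enorm) hsum] with w hw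
  exact (NNReal.summable_coe.2 (ENNReal.tsum_coe_ne_top_iff_summable.1 hw.ne)).of_norm

/-- The law of the sum of the series is determined by the weights. -/
lemma identDistrib_tsum_mul_chiSquared {Ω' : Type*} [MeasurableSpace Ω'] {P' : Measure Ω'}
    {V' : ℕ → Ω' → ℝ}
    (hV : ∀ j, HasLaw (V j) (chiSquared m) P) (hVi : iIndepFun V P)
    (hV' : ∀ j, HasLaw (V' j) (chiSquared m) P') (hVi' : iIndepFun V' P')
    (ha0 : ∀ j, 0 ≤ a j) :
    IdentDistrib (fun w => ∑' j, a j * V j w) (fun w => ∑' j, a j * V' j w) P P' := by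
  -- for nonnegative terms the sum is a measurable function of the sequence of terms
  have hG : Measurable fun x : ℕ → ℝ => (∑' j, ENNReal.ofReal (a j * x j)).toReal := by fun_prop
  have key : ∀ x : ℕ → ℝ, (∀ j, 0 ≤ x j) →
      (∑' j, ENNReal.ofReal (a j * x j)).toReal = ∑' j, a j * x j := fun x hx => by
    rw [ENNReal.tsum_toReal_eq fun j => ENNReal.ofReal_ne_top]
    exact tsum_congr fun j => ENNReal.toReal_ofReal (mul_nonneg (ha0 j) (hx j))
  have hm : AEMeasurable (fun w j => V j w) P := aemeasurable_pi_iff.2 fun j => (hV j).aemeasurable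
  have hm' : AEMeasurable (fun w j => V' j w) P' :=
    aemeasurable_pi_iff.2 fun j => (hV' j).aemeasurable
  have hid : IdentDistrib (fun w j => V j w) (fun w j => V' j w) P P' :=
    ⟨hm, hm', by rw [(hVi.hasLaw_infinitePi hV hm).map_eq, (hVi'.hasLaw_infinitePi hV' hm').map_eq]⟩
  have h1 : (fun w => (∑' j, ENNReal.ofReal (a j * V j w)).toReal) =ᵐ[P]
      fun w => ∑' j, a j * V j w := by
    filter_upwards [ae_nonneg_of_hasLaw_chiSquared hV] with w hw using key _ hw
  have h2 : (fun w => (∑' j, ENNReal.ofReal (a j * V' j w)).toReal) =ᵐ[P']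
      fun w => ∑' j, a j * V' j w := by
    filter_upwards [ae_nonneg_of_hasLaw_chiSquared hV'] with w hw using key _ hw
  have h3 := hid.comp hG
  exact ((IdentDistrib.of_ae_eq h3.aemeasurable_fst h1).symm.trans h3).trans
    (IdentDistrib.of_ae_eq h3.aemeasurable_snd h2)

lemma aemeasurable_tsum_mul_chiSquared (hV : ∀ j, HasLaw (V j) (chiSquared m) P)
    (hVi : iIndepFun V P) (ha0 : ∀ j, 0 ≤ a j) : AEMeasurable (fun w => ∑' j, a j * V j w) P :=
  (identDistrib_tsum_mul_chiSquared hV hVi hV hVi ha0).aemeasurable_fst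

/-- The exponential moments of the finite partial sums. -/
lemma integral_cexp_mul_finsetSum (hV : ∀ j, HasLaw (V j) (chiSquared m) P)
    (hVi : iIndepFun V P) {z : ℂ} (s : Finset ℕ) (hz : ∀ j ∈ s, (z * a j).re < 1 / 2) :
    ∫ w, Complex.exp (z * ((∑ j ∈ s, a j * V j w : ℝ) : ℂ)) ∂P =
      ∏ j ∈ s, (1 - 2 * (z * a j)) ^ (-((m : ℂ) / 2)) := by
  have h : ∀ w, Complex.exp (z * ((∑ j ∈ s, a j * V j w : ℝ) : ℂ)) =
      ∏ j : s, Complex.exp (z * a j * (V j w : ℂ)) := by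
    intro w
    rw [← Complex.exp_sum, Finset.sum_coe_sort s (fun j => z * a j * (V j w : ℂ))]
    push_cast
    rw [Finset.mul_sum]
    simp only [mul_assoc]
  simp_rw [h]
  rw [(hVi.precomp Subtype.val_injective).integral_fun_prod_comp (X := fun j : s => V j)
    (f := fun (j : s) (x : ℝ) => Complex.exp (z * a j * (x : ℂ)))
    (fun j => (hV j).aemeasurable) (fun j => by fun_prop),
    ← Finset.prod_coe_sort s]
  refine Finset.prod_congr rfl fun j _ => ?_
  rw [← integral_cexp_mul_chiSquared m (hz j j.2)]
  exact (hV j).integral_comp (f := fun x : ℝ => Complex.exp (z * a j * (x : ℂ))) (by fun_prop)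

lemma integral_exp_mul_finsetSum (hV : ∀ j, HasLaw (V j) (chiSquared m) P)
    (hVi : iIndepFun V P) {t : ℝ} (s : Finset ℕ) (ht : ∀ j ∈ s, t * a j < 1 / 2) :
    ∫ w, Real.exp (t * ∑ j ∈ s, a j * V j w) ∂P =
      ∏ j ∈ s, (1 - 2 * (t * a j)) ^ (-((m : ℝ) / 2)) := by
  have h := integral_cexp_mul_finsetSum hV hVi (z := (t : ℂ)) s
    (fun j hj => by simpa [← Complex.ofReal_mul] using ht j hj)
  rw [← Complex.ofReal_inj, ← integral_complex_ofReal]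
  push_cast at h ⊢
  rw [h]
  refine Finset.prod_congr rfl fun j hj => ?_
  rw [Complex.ofReal_cpow (by linarith [ht j hj])]
  push_cast
  rfl

/-- The products `∏ (1 - 2 t a_j)^{-m/2}` are bounded: `(1 - x)⁻¹ ≤ exp (x / (1 - x))`, and the
numbers `x / (1 - x)` for `x = 2 t a_j` form a summable family. -/
lemma exists_prod_rpow_le (ha0 : ∀ j, 0 ≤ a j) (ha : Summable a) {t : ℝ} (ht0 : 0 ≤ t)
    (ht : ∀ j, t * a j < 1 / 2) :
    ∃ C : ℝ, ∀ s : Finset ℕ, ∏ j ∈ s, (1 - 2 * (t * a j)) ^ (-((m : ℝ) / 2)) ≤ C := by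
  set x : ℕ → ℝ := fun j => 2 * (t * a j) with hx
  have hx0 : ∀ j, 0 ≤ x j := fun j => by have := mul_nonneg ht0 (ha0 j); simp only [hx]; linarith
  have hx1 : ∀ j, 0 < 1 - x j := fun j => by have := ht j; simp only [hx]; linarith
  have hxs : Summable x := (ha.mul_left t).mul_left 2
  have hy0 : ∀ j, 0 ≤ x j / (1 - x j) := fun j => div_nonneg (hx0 j) (hx1 j).le
  have hys : Summable fun j => x j / (1 - x j) := by
    refine summable_of_isBigO_nat hxs ?_
    refine Asymptotics.IsBigO.of_bound 2 ?_
    filter_upwards [hxs.tendsto_atTop_zero.eventually (gt_mem_nhds (show (0 : ℝ) < 1 / 2 by norm_num))]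
      with j hj
    rw [Real.norm_of_nonneg (hy0 j), Real.norm_of_nonneg (hx0 j), div_le_iff₀ (hx1 j)]
    nlinarith [hx0 j]
  refine ⟨Real.exp (∑' j, x j / (1 - x j) * (m / 2)), fun s => ?_⟩
  calc ∏ j ∈ s, (1 - x j) ^ (-((m : ℝ) / 2))
      ≤ ∏ j ∈ s, Real.exp (x j / (1 - x j) * (m / 2)) := by
        refine Finset.prod_le_prod (fun j _ => (Real.rpow_pos_of_pos (hx1 j) _).le) fun j _ => ?_
        rw [Real.rpow_neg (hx1 j).le, ← Real.inv_rpow (hx1 j).le, Real.exp_mul]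
        refine Real.rpow_le_rpow (inv_nonneg.2 (hx1 j).le) ?_ (by positivity)
        have h1 : (1 - x j)⁻¹ = x j / (1 - x j) + 1 := by
          field_simp [(hx1 j).ne']
          ring
        rw [h1]
        exact Real.add_one_le_exp _
    _ = Real.exp (∑ j ∈ s, x j / (1 - x j) * (m / 2)) := (Real.exp_sum _ _).symm
    _ ≤ _ := Real.exp_le_exp.2 ((hys.mul_right _).sum_le_tsum s
        fun j _ => mul_nonneg (hy0 j) (by positivity))

/-- Exponential integrability of the sum: by Fatou's lemma for `0 ≤ t`, and trivially otherwise. -/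
lemma integrable_exp_mul_tsum [IsFiniteMeasure P] (hV : ∀ j, HasLaw (V j) (chiSquared m) P)
    (hVi : iIndepFun V P) (ha0 : ∀ j, 0 ≤ a j) (ha : Summable a) {t : ℝ}
    (ht : ∀ j, t * a j < 1 / 2) : Integrable (fun w => Real.exp (t * ∑' j, a j * V j w)) P := by
  have hmeas := aemeasurable_tsum_mul_chiSquared hV hVi ha0
  rcases le_total 0 t with ht0 | ht0
  · obtain ⟨C, hC⟩ := exists_prod_rpow_le (m := m) ha0 ha ht0 ht
    refine ⟨(hmeas.const_mul t).exp.aestronglyMeasurable, ?_⟩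
    have hpart : ∀ N : ℕ, ∫⁻ w, ‖Real.exp (t * ∑ j ∈ Finset.range N, a j * V j w)‖ₑ ∂P ≤
        ENNReal.ofReal C := by
      intro N
      have hint : Integrable (fun w => Real.exp (t * ∑ j ∈ Finset.range N, a j * V j w)) P := by
        refine Integrable.of_integral_ne_zero ?_
        rw [integral_exp_mul_finsetSum hV hVi _ fun j _ => ht j]
        exact (Finset.prod_pos fun j _ => Real.rpow_pos_of_pos (by linarith [ht j]) _).ne'
      simp_rw [Real.enorm_of_nonneg (Real.exp_pos _).le]
      rw [← ofReal_integral_eq_lintegral_ofReal hint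
        (Eventually.of_forall fun w => (Real.exp_pos _).le),
        integral_exp_mul_finsetSum hV hVi _ fun j _ => ht j]
      exact ENNReal.ofReal_le_ofReal (hC _)
    have hlim : ∫⁻ w, ‖Real.exp (t * ∑' j, a j * V j w)‖ₑ ∂P ≤
        liminf (fun N : ℕ => ∫⁻ w, ‖Real.exp (t * ∑ j ∈ Finset.range N, a j * V j w)‖ₑ ∂P)
          atTop := by
      refine le_trans (lintegral_mono_ae ?_) (lintegral_liminf_le' fun N => ?_)
      · filter_upwards [ae_summable_mul_chiSquared hV ha0 ha] with w hw
        refine ((Tendsto.liminf_eq ?_).symm).le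
        exact ((Real.continuous_exp.enorm.tendsto _).comp
          (hw.hasSum.tendsto_sum_nat.const_mul t))
      · exact ((Finset.aemeasurable_fun_sum _ fun j _ =>
          (hV j).aemeasurable.const_mul _).const_mul t).exp.enorm
    refine lt_of_le_of_lt (hlim.trans ?_) (ENNReal.ofReal_lt_top (r := C))
    exact (liminf_le_liminf (Eventually.of_forall hpart)).trans_eq (liminf_const _)
  · refine (integrable_const (1 : ℝ)).mono' (hmeas.const_mul t).exp.aestronglyMeasurable ?_
    filter_upwards [ae_nonneg_of_hasLaw_chiSquared hV] with w hw
    rw [Real.norm_of_nonneg (Real.exp_pos _).le, Real.exp_le_one_iff]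
    exact mul_nonpos_of_nonpos_of_nonneg ht0 (tsum_nonneg fun j => mul_nonneg (ha0 j) (hw j))

/-- The exponential moment of the sum is an infinite product: dominated convergence along the net
of finite partial sums. -/
lemma hasProd_integral_cexp_mul_tsum [IsFiniteMeasure P] (hV : ∀ j, HasLaw (V j) (chiSquared m) P)
    (hVi : iIndepFun V P) (ha0 : ∀ j, 0 ≤ a j) (ha : Summable a) {z : ℂ}
    (hz : ∀ j, z.re * a j < 1 / 2) :
    HasProd (fun j => (1 - 2 * (z * a j)) ^ (-((m : ℂ) / 2)))
      (∫ w, Complex.exp (z * ((∑' j, a j * V j w : ℝ) : ℂ)) ∂P) := by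
  -- the partial sums are between `0` and the sum, whence the bound with the positive part of `Re z`
  have hz' : ∀ j, max z.re 0 * a j < 1 / 2 := fun j => by
    rcases max_cases z.re 0 with h | h <;> rw [h.1]
    · exact hz j
    · norm_num
  have hint := integrable_exp_mul_tsum hV hVi ha0 ha hz'
  have hre : ∀ j, (z * a j).re < 1 / 2 := fun j => by simpa using hz j
  have h : ∀ s : Finset ℕ, ∏ j ∈ s, (1 - 2 * (z * a j)) ^ (-((m : ℂ) / 2)) =
      ∫ w, Complex.exp (z * ((∑ j ∈ s, a j * V j w : ℝ) : ℂ)) ∂P := fun s =>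
    (integral_cexp_mul_finsetSum hV hVi s fun j _ => hre j).symm
  rw [HasProd]
  simp_rw [h]
  refine tendsto_integral_filter_of_dominated_convergence
    (fun w => Real.exp (max z.re 0 * ∑' j, a j * V j w)) ?_ ?_ hint ?_
  · refine Eventually.of_forall fun s => AEMeasurable.aestronglyMeasurable ?_
    exact Complex.measurable_exp.comp_aemeasurable ((Complex.measurable_ofReal.comp_aemeasurable
      (Finset.aemeasurable_fun_sum _ fun j _ => (hV j).aemeasurable.const_mul _)).const_mul z)
  · refine Eventually.of_forall fun s => ?_
    filter_upwards [ae_summable_mul_chiSquared hV ha0 ha, ae_nonneg_of_hasLaw_chiSquared hV]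
      with w hw hw0
    rw [Complex.norm_exp, Real.exp_le_exp, Complex.re_mul_ofReal]
    have h0 : ∀ j, 0 ≤ a j * V j w := fun j => mul_nonneg (ha0 j) (hw0 j)
    exact mul_le_mul (le_max_left _ _) (hw.sum_le_tsum s fun j _ => h0 j)
      (Finset.sum_nonneg fun j _ => h0 j) (le_max_right _ _)
  · filter_upwards [ae_summable_mul_chiSquared hV ha0 ha] with w hw
    exact (Complex.continuous_exp.tendsto _).comp
      (((Complex.continuous_ofReal.tendsto _).comp hw.hasSum).const_mul z)

lemma hasProd_integral_exp_mul_tsum [IsFiniteMeasure P] (hV : ∀ j, HasLaw (V j) (chiSquared m) P)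
    (hVi : iIndepFun V P) (ha0 : ∀ j, 0 ≤ a j) (ha : Summable a) {t : ℝ}
    (ht : ∀ j, t * a j < 1 / 2) :
    HasProd (fun j => (1 - 2 * (t * a j)) ^ (-((m : ℝ) / 2)))
      (∫ w, Real.exp (t * ∑' j, a j * V j w) ∂P) := by
  have h := hasProd_integral_cexp_mul_tsum hV hVi ha0 ha (z := (t : ℂ)) (by simpa using ht)
  have h2 : Complex.reCLM (∫ w, Complex.exp (t * ((∑' j, a j * V j w : ℝ) : ℂ)) ∂P) =
      ∫ w, Real.exp (t * ∑' j, a j * V j w) ∂P := by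
    rw [← Complex.ofReal_re (∫ w, Real.exp (t * ∑' j, a j * V j w) ∂P), ← integral_complex_ofReal]
    simp
  rw [HasProd, ← h2]
  refine ((Complex.reCLM.continuous.tendsto _).comp h).congr fun s => ?_
  rw [Function.comp_apply]
  have h3 : ∀ j, (1 - 2 * ((t : ℂ) * a j)) ^ (-((m : ℂ) / 2)) =
      (((1 - 2 * (t * a j)) ^ (-((m : ℝ) / 2)) : ℝ) : ℂ) := fun j => by
    rw [Complex.ofReal_cpow (by linarith [ht j])]
    push_cast
    rfl
  simp_rw [h3]
  rw [← Complex.ofReal_prod]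
  rfl

end Series

/-! ### Convergence of random series -/

section Convergence

variable {Ω : Type*} [MeasurableSpace Ω] {P : Measure Ω}

/-- Kolmogorov's one-series theorem: a series of independent centered square integrable variables
with summable variances converges almost surely. Its partial sums form a martingale which is bounded
in `L²`. -/
lemma ae_exists_tendsto_sum_of_summable_variance [IsProbabilityMeasure P] {X : ℕ → Ω → ℝ}
    (hXm : ∀ j, Measurable (X j)) (hX : ∀ j, MemLp (X j) 2 P) (hXi : iIndepFun X P)
    (hX0 : ∀ j, ∫ w, X j w ∂P = 0) (hvar : Summable fun j => Var[X j; P]) :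
    ∀ᵐ w ∂P, ∃ c, Tendsto (fun N => ∑ j ∈ Finset.range N, X j w) atTop (𝓝 c) := by
  have hsm : ∀ j, StronglyMeasurable (X j) := fun j => (hXm j).stronglyMeasurable
  set ℱ := Filtration.natural X hsm
  set S : ℕ → Ω → ℝ := fun N => ∑ j ∈ Finset.range (N + 1), X j with hS
  have hL2 : ∀ N, MemLp (S N) 2 P := fun N => memLp_finsetSum' _ fun j _ => hX j
  have hint : ∀ j, Integrable (X j) P := fun j => (hX j).integrable one_le_two
  have hmart : Martingale S ℱ P := by
    refine martingale_of_condExp_sub_eq_zero_nat (fun N => ?_)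
      (fun N => (hL2 N).integrable one_le_two) fun N => ?_
    · refine Finset.stronglyMeasurable_sum _ fun j hj => ?_
      exact (Filtration.stronglyAdapted_natural hsm j).mono
        (ℱ.mono (Nat.lt_succ_iff.1 (Finset.mem_range.1 hj)))
    · have h : S (N + 1) - S N = X (N + 1) := by
        simp only [hS]
        rw [Finset.sum_range_succ _ (N + 1), add_sub_cancel_left]
      rw [h]
      refine (hXi.condExp_natural_ae_eq_of_lt hsm (Nat.lt_succ_self N)).trans ?_
      rw [hX0]
      rfl
  have hbdd : ∀ N, eLpNorm (S N) 1 P ≤ ((Real.sqrt (∑' j, Var[X j; P])).toNNReal : NNReal) := by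
    intro N
    refine (eLpNorm_le_eLpNorm_of_exponent_le one_le_two (hL2 N).1).trans ?_
    have hmean : ∫ w, S N w ∂P = 0 := by
      simp only [hS, Finset.sum_apply]
      rw [integral_finsetSum _ fun j _ => hint j]
      simp [hX0]
    have hv : ∫ w, S N w ^ 2 ∂P ≤ ∑' j, Var[X j; P] := by
      have h1 : Var[S N; P] = ∫ w, S N w ^ 2 ∂P :=
        variance_of_integral_eq_zero (hL2 N).1.aemeasurable hmean
      rw [← h1, IndepFun.variance_sum (fun j _ => hX j) fun i _ j _ hij => hXi.indepFun hij]
      exact hvar.sum_le_tsum _ fun j _ => variance_nonneg _ _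
    rw [(hL2 N).eLpNorm_eq_integral_rpow_norm two_ne_zero ENNReal.ofNat_ne_top]
    refine ENNReal.ofReal_le_ofReal ?_
    rw [Real.sqrt_eq_rpow]
    simp only [ENNReal.toReal_ofNat, Real.rpow_ofNat, Real.norm_eq_abs, sq_abs, ← one_div]
    exact Real.rpow_le_rpow (integral_nonneg fun w => sq_nonneg _) hv (by norm_num)
  filter_upwards [hmart.submartingale.exists_ae_tendsto_of_bdd hbdd] with w ⟨c, hc⟩
  refine ⟨c, (tendsto_add_atTop_iff_nat 1).1 ?_⟩
  simpa [hS] using hc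

/-- A series of independent standard Gaussian vectors with square summable coefficients, composed
with a linear map, converges almost surely. -/
lemma ae_exists_tendsto_sum_smul_stdGaussian {n : ℕ} {E : Type*} [NormedAddCommGroup E]
    [InnerProductSpace ℝ E] [FiniteDimensional ℝ E] [MeasurableSpace E] [BorelSpace E]
    [IsProbabilityMeasure P] {ξ : ℕ → Ω → E} (hξm : ∀ j, Measurable (ξ j))
    (hξ : ∀ j, HasLaw (ξ j) (stdGaussian E) P) (hξi : iIndepFun ξ P)
    (T : E →L[ℝ] EuclideanSpace ℝ (Fin n)) {c : ℕ → ℝ} (hc : Summable fun j => c j ^ 2) :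
    ∀ᵐ w ∂P, ∃ l, Tendsto (fun N => ∑ j ∈ Finset.range N, c j • T (ξ j w)) atTop (𝓝 l) := by
  have hcoord : ∀ i, ∀ᵐ w ∂P, ∃ l,
      Tendsto (fun N => ∑ j ∈ Finset.range N, c j * T (ξ j w) i) atTop (𝓝 l) := by
    intro i
    set L : StrongDual ℝ E := (EuclideanSpace.proj i).comp T
    have hLm : Measurable L := L.continuous.measurable
    have hL2 : MemLp L 2 (stdGaussian E) := IsGaussian.memLp_dual _ L 2 ENNReal.ofNat_ne_top
    have hmem : ∀ j, MemLp (fun w => L (ξ j w)) 2 P := fun j => by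
      have := hL2
      rw [← (hξ j).map_eq] at this
      exact this.comp_of_map (hξm j).aemeasurable
    refine ae_exists_tendsto_sum_of_summable_variance (X := fun j w => c j * L (ξ j w))
      (fun j => (hLm.comp (hξm j)).const_mul _) (fun j => (hmem j).const_mul _)
      (hξi.comp (fun j v => c j * L v) fun j => hLm.const_mul _) (fun j => ?_) ?_
    · rw [integral_const_mul]
      have := (hξ j).integral_comp (f := L) hLm.aestronglyMeasurable
      rw [integral_strongDual_stdGaussian] at this
      exact mul_eq_zero_of_right _ this
    · have hv : ∀ j, Var[fun w => c j * L (ξ j w); P] = c j ^ 2 * Var[L; stdGaussian E] := by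
        intro j
        rw [variance_const_mul, ← (hξ j).map_eq, variance_map hLm.aemeasurable
          (hξm j).aemeasurable]
        rfl
      simp_rw [hv]
      exact hc.mul_right _
  filter_upwards [ae_all_iff.2 hcoord] with w hw
  choose l hl using hw
  refine ⟨WithLp.toLp 2 l, ?_⟩
  have h := ((PiLp.continuous_toLp 2 (fun _ : Fin n => ℝ)).tendsto l).comp
    (tendsto_pi_nhds.2 hl)
  refine h.congr fun N => ?_
  ext i
  simp

end Convergence

/-! ### Orthonormal series -/

section Orthonormal

variable {M : Type*} [MeasurableSpace M] {dv : Measure M} {ψ : ℕ → M → ℝ}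

/-- Summability almost everywhere of the squares, whose integrals `c_j²` are summable. -/
lemma ae_summable_sq_mul_orthonormal (hψ : ∀ j, MemLp (ψ j) 2 dv)
    (hψ1 : ∀ j, ∫ x, ψ j x * ψ j x ∂dv = 1) {c : ℕ → ℝ} (hc : Summable fun j => c j ^ 2) :
    ∀ᵐ x ∂dv, Summable fun j => (c j * ψ j x) ^ 2 := by
  have hE : ∀ j, ∫⁻ x, ‖(c j * ψ j x) ^ 2‖ₑ ∂dv = ENNReal.ofReal (c j ^ 2) := by
    intro j
    have hint : Integrable (fun x => (c j * ψ j x) ^ 2) dv := ((hψ j).const_mul (c j)).integrable_sq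
    simp_rw [Real.enorm_of_nonneg (sq_nonneg _)]
    rw [← ofReal_integral_eq_lintegral_ofReal hint (Eventually.of_forall fun x => sq_nonneg _)]
    simp_rw [mul_pow]
    rw [integral_const_mul]
    simp_rw [sq (ψ j _)]
    rw [hψ1, mul_one]
  have hm : ∀ j, AEMeasurable (fun x => ‖(c j * ψ j x) ^ 2‖ₑ) dv := fun j =>
    (((hψ j).1.aemeasurable.const_mul _).pow_const 2).enorm
  have hsum : ∫⁻ x, ∑' j, ‖(c j * ψ j x) ^ 2‖ₑ ∂dv ≠ ⊤ := by
    rw [lintegral_tsum hm]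
    simp_rw [hE]
    exact hc.tsum_ofReal_ne_top
  filter_upwards [ae_lt_top' (AEMeasurable.tsum hm) hsum] with x hx
  exact (NNReal.summable_coe.2 (ENNReal.tsum_coe_ne_top_iff_summable.1 hx.ne)).of_norm

/-- Parseval's identity for the pointwise limit of an orthonormal series: the pointwise limit is
the limit in `L²`. -/
lemma memLp_and_integral_sq_of_orthonormal [IsFiniteMeasure dv] (hψ : ∀ j, MemLp (ψ j) 2 dv)
    (hψo : ∀ i j, ∫ x, ψ i x * ψ j x ∂dv = if i = j then 1 else 0) {c : ℕ → ℝ}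
    (hc : Summable fun j => c j ^ 2) {u : M → ℝ}
    (hu : ∀ᵐ x ∂dv, Tendsto (fun N => ∑ j ∈ Finset.range N, c j * ψ j x) atTop (𝓝 (u x))) :
    MemLp u 2 dv ∧ ∫ x, u x ^ 2 ∂dv = ∑' j, c j ^ 2 := by
  set e : ℕ → Lp ℝ 2 dv := fun j => (hψ j).toLp with he
  have hinner : ∀ {p q : M → ℝ} (hp : MemLp p 2 dv) (hq : MemLp q 2 dv),
      inner ℝ hp.toLp hq.toLp = ∫ x, p x * q x ∂dv := by
    intro p q hp hq
    rw [L2.inner_def]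
    refine integral_congr_ae ?_
    filter_upwards [hp.coeFn_toLp, hq.coeFn_toLp] with x hx hy
    rw [hx, hy, real_inner_comm]
    rfl
  have ho : Orthonormal ℝ e := orthonormal_iff_ite.2 fun i j => by rw [he, hinner, hψo]
  have hsum : Summable fun j => c j • e j := by
    have := (ho.orthogonalFamily.summable_iff_norm_sq_summable c).2 (by simpa using hc)
    simpa using this
  have hlim := hsum.hasSum.tendsto_sum_nat
  set v : Lp ℝ 2 dv := ∑' j, c j • e j
  have hnorm : ‖v‖ ^ 2 = ∑' j, c j ^ 2 := by
    refine tendsto_nhds_unique (hlim.norm.pow 2) ?_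
    refine hc.hasSum.tendsto_sum_nat.congr fun N => ?_
    rw [← real_inner_self_eq_norm_sq, ho.inner_sum]
    exact Finset.sum_congr rfl fun j _ => by simp [sq]
  have hmeas : TendstoInMeasure dv (fun N x => ∑ j ∈ Finset.range N, c j * ψ j x) atTop v := by
    refine (tendstoInMeasure_of_tendsto_Lp hlim).congr_left fun N => ?_
    filter_upwards [Lp.coeFn_fun_finsetSum (Finset.range N) fun j => c j • e j,
      ae_all_iff.2 fun j => Lp.coeFn_smul (c j) (e j),
      ae_all_iff.2 fun j => (hψ j).coeFn_toLp] with x h1 h2 h3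
    rw [h1]
    exact Finset.sum_congr rfl fun j _ => by rw [h2, Pi.smul_apply, h3, smul_eq_mul]
  have huv : u =ᵐ[dv] v := tendstoInMeasure_ae_unique
    (tendstoInMeasure_of_tendsto_ae (fun N => (memLp_finsetSum (Finset.range N)
      fun j _ => (hψ j).const_mul (c j)).1) hu) hmeas
  refine ⟨(memLp_congr_ae huv).2 (Lp.memLp v), ?_⟩
  rw [← hnorm, ← real_inner_self_eq_norm_sq, L2.inner_def]
  refine integral_congr_ae ?_
  filter_upwards [huv] with x hx
  rw [hx, real_inner_self_eq_norm_sq, Real.norm_eq_abs, sq_abs]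

/-- Parseval's identity for orthonormal series with vector coefficients. -/
lemma integrable_and_integral_norm_sq_of_orthonormal [IsFiniteMeasure dv]
    (hψ : ∀ j, MemLp (ψ j) 2 dv)
    (hψo : ∀ i j, ∫ x, ψ i x * ψ j x ∂dv = if i = j then 1 else 0) {n : ℕ}
    {c : ℕ → EuclideanSpace ℝ (Fin n)} (hc : Summable fun j => ‖c j‖ ^ 2)
    {u : M → EuclideanSpace ℝ (Fin n)}
    (hu : ∀ᵐ x ∂dv, Tendsto (fun N => ∑ j ∈ Finset.range N, ψ j x • c j) atTop (𝓝 (u x))) :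
    Integrable (fun x => ‖u x‖ ^ 2) dv ∧ ∫ x, ‖u x‖ ^ 2 ∂dv = ∑' j, ‖c j‖ ^ 2 := by
  have hci : ∀ i, Summable fun j => c j i ^ 2 := fun i => by
    refine hc.of_nonneg_of_le (fun j => sq_nonneg _) fun j => ?_
    rw [EuclideanSpace.real_norm_sq_eq]
    exact Finset.single_le_sum (fun i _ => sq_nonneg (c j i)) (Finset.mem_univ i)
  have h : ∀ i, MemLp (fun x => u x i) 2 dv ∧ ∫ x, u x i ^ 2 ∂dv = ∑' j, c j i ^ 2 := fun i => by
    refine memLp_and_integral_sq_of_orthonormal hψ hψo (hci i) ?_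
    filter_upwards [hu] with x hx
    refine (((EuclideanSpace.proj i : EuclideanSpace ℝ (Fin n) →L[ℝ] ℝ).continuous.tendsto
      _).comp hx).congr fun N => ?_
    simp [mul_comm]
  simp_rw [EuclideanSpace.real_norm_sq_eq]
  refine ⟨integrable_finsetSum _ fun i _ => (h i).1.integrable_sq, ?_⟩
  rw [integral_finsetSum _ fun i _ => (h i).1.integrable_sq, Summable.tsum_finsetSum
    fun i _ => hci i]
  exact Finset.sum_congr rfl fun i _ => (h i).2

end Orthonormal

/-! ### The random field -/

section Field

variable {n : ℕ} {M Ω : Type*} {β : ℕ → ℝ} {ψ : ℕ → M → ℝ} {ξ : ℕ → Ω → EuclideanSpace ℝ (Fin n)}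

lemma partialField_eq_sum_range (N : ℕ) (w : Ω) (x : M) :
    partialField β ψ ξ N w x = ∑ j ∈ Finset.range N,
      (β (j + 1) * ψ (j + 1) x) • (hyperplane n).starProjection (ξ (j + 1) w) := by
  rw [partialField, Finset.range_eq_Ico, Finset.sum_Ico_add'
    (fun j => (β j * ψ j x) • (hyperplane n).starProjection (ξ j w))]
  rfl

lemma tendsto_radialField {w : Ω} {x : M}
    (h : ∃ L, Tendsto (fun N => partialField β ψ ξ N w x) atTop (𝓝 L)) :
    Tendsto (fun N => partialField β ψ ξ N w x) atTop (𝓝 (radialField β ψ ξ w x)) := by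
  rw [radialField, dif_pos h]
  exact h.choose_spec

/-- The field takes values in the closed hyperplane, also at the points where the series diverges and
the field is `0` by convention. -/
lemma sum_radialField_eq_zero (w : Ω) (x : M) : ∑ i, radialField β ψ ξ w x i = 0 := by
  by_cases h : ∃ L, Tendsto (fun N => partialField β ψ ξ N w x) atTop (𝓝 L)
  · refine (hyperplane n).closed_of_finiteDimensional.mem_of_tendsto (tendsto_radialField h)
      (Eventually.of_forall fun N => ?_)
    exact Submodule.sum_mem _ fun j _ => Submodule.smul_mem _ _
      (Submodule.starProjection_apply_mem _ _)
  · rw [radialField, dif_neg h]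
    simp

/-- The series defining the field converges almost everywhere: for almost every point of `M` it
converges almost surely, and Fubini's theorem exchanges the two quantifiers. -/
lemma ae_ae_tendsto_partialField [MeasurableSpace M] {dv : Measure M} [IsFiniteMeasure dv]
    (hψm : ∀ j, Measurable (ψ j)) (hψ : ∀ j, MemLp (ψ j) 2 dv)
    (hψ1 : ∀ j, ∫ x, ψ j x * ψ j x ∂dv = 1) (hβ : Summable fun j => β j ^ 2)
    [MeasurableSpace Ω] {P : Measure Ω} [IsProbabilityMeasure P] (hξm : ∀ j, Measurable (ξ j))
    (hξ : ∀ j, HasLaw (ξ j) (stdGaussian (EuclideanSpace ℝ (Fin n))) P) (hξi : iIndepFun ξ P) :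
    ∀ᵐ w ∂P, ∀ᵐ x ∂dv, Tendsto (fun N => partialField β ψ ξ N w x) atTop
      (𝓝 (radialField β ψ ξ w x)) := by
  have hmeas : MeasurableSet {p : Ω × M |
      ∃ L, Tendsto (fun N => partialField β ψ ξ N p.1 p.2) atTop (𝓝 L)} := by
    refine StronglyMeasurable.measurableSet_exists_tendsto fun N => Measurable.stronglyMeasurable ?_
    refine Finset.measurable_sum _ fun j _ => ?_
    exact (((hψm j).comp measurable_snd).const_mul _).smul
      ((hyperplane n).starProjection.continuous.measurable.comp ((hξm j).comp measurable_fst))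
  have hae : ∀ᵐ w ∂P, ∀ᵐ x ∂dv,
      ∃ L, Tendsto (fun N => partialField β ψ ξ N w x) atTop (𝓝 L) := by
    rw [Measure.ae_ae_comm hmeas]
    filter_upwards [ae_summable_sq_mul_orthonormal hψ hψ1 hβ] with x hx
    have hx' : Summable fun j => (β (j + 1) * ψ (j + 1) x) ^ 2 :=
      (summable_nat_add_iff (f := fun j => (β j * ψ j x) ^ 2) 1).2 hx
    filter_upwards [ae_exists_tendsto_sum_smul_stdGaussian (fun j => hξm (j + 1))
      (fun j => hξ (j + 1)) (hξi.precomp (add_left_injective 1))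
      (hyperplane n).starProjection hx'] with w hw
    simp_rw [partialField_eq_sum_range]
    exact hw
  filter_upwards [hae] with w hw
  filter_upwards [hw] with x hx using tendsto_radialField hx

end Field

end RandomMetric

/-! ### The law of `Ω₂²` -/

open RandomMetric in
theorem mainTheorem1 {n : ℕ} (hn : 1 ≤ n)
    -- the compact manifold with its volume, the reference metric, the orthonormal frame
    {M : Type*} [TopologicalSpace M] [T2Space M] [CompactSpace M]
    [ChartedSpace (EuclideanSpace ℝ (Fin n)) M] [IsManifold (𝓡 n) ∞ M]
    [MeasurableSpace M] [BorelSpace M]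
    (dv : Measure M) [IsFiniteMeasure dv]
    (g₀ : Bundle.ContMDiffRiemannianMetric (𝓡 n) ∞ (EuclideanSpace ℝ (Fin n))
      (fun x : M => TangentSpace (𝓡 n) x))
    (hg₀ : HasVolume (ofMetric g₀) dv)
    (f : Fin n → ∀ x : M, TangentSpace (𝓡 n) x)
    (hf : IsOrthonormalFrame (ofMetric g₀) f)
    -- the Laplace eigenbasis and the decay coefficients
    (ψ : ℕ → M → ℝ) (ev : ℕ → ℝ) (hψ : IsLaplaceEigenbasis (ofMetric g₀) dv ψ ev)
    (F : ℝ → ℝ) (hF : ∃ T, AntitoneOn F (Set.Ici T)) (hF0 : Tendsto F atTop (𝓝 0))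
    (β : ℕ → ℝ) (hβ : ∀ j, β j = F (ev j)) (hβ2 : Summable fun j => β j ^ 2)
    -- the Gaussian vectors, and an arbitrary field of rotations
    {Ω : Type*} [MeasurableSpace Ω] (P : Measure Ω) [IsProbabilityMeasure P]
    (ξ : ℕ → Ω → EuclideanSpace ℝ (Fin n)) (hξm : ∀ j, Measurable (ξ j))
    (hξ : ∀ j, HasLaw (ξ j) (stdGaussian (EuclideanSpace ℝ (Fin n))) P)
    (hξi : iIndepFun ξ P)
    (k : Ω → M → Matrix.specialOrthogonalGroup (Fin n) ℝ)
    -- the random metric and the random variable `Ω₂²(g⁰, g¹)`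
    (g₁ : Ω → FormField n M)
    (hg₁ : ∀ w, g₁ w = deformedMetric hf (radialField β ψ ξ w) (k w))
    (W : Ω → ℝ) (hW : ∀ w, W w = omegaTwoSq hf dv (ofMetric g₀) (g₁ w)) :
    -- the series converges almost everywhere, `g¹` lies in `Met_dv(M)`, and `Ω₂²` is finite
    (∀ᵐ w ∂P, ∀ᵐ x ∂dv, Tendsto (fun N => partialField β ψ ξ N w x) atTop
      (𝓝 (radialField β ψ ξ w x))) ∧
    (∀ w, g₁ w ∈ MetDv dv) ∧
    (∀ᵐ w ∂P, Integrable (fun x => fibreDist hf (ofMetric g₀) (g₁ w) x ^ 2) dv) ∧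
    -- the law
    (∀ {Ω' : Type*} [MeasurableSpace Ω'] (P' : Measure Ω') [IsProbabilityMeasure P']
      (V : ℕ → Ω' → ℝ), (∀ j, HasLaw (V j) (chiSquared (n - 1)) P') → iIndepFun V P' →
      (∀ᵐ w' ∂P', Summable fun j : ℕ => β (j + 1) ^ 2 * V j w') ∧
      IdentDistrib W (fun w' => ∑' j : ℕ, β (j + 1) ^ 2 * V j w') P P') ∧
    -- the moment generating function
    (∀ t : ℝ, (∀ j : ℕ, 2 * t * β (j + 1) ^ 2 < 1) →
      Integrable (fun w => Real.exp (t * W w)) P ∧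
      HasProd (fun j : ℕ => (1 - 2 * t * β (j + 1) ^ 2) ^ (-(((n : ℝ) - 1) / 2))) (mgf W P t)) ∧
    -- the characteristic function
    (∀ t : ℝ, HasProd
      (fun j : ℕ => (1 - 2 * Complex.I * (t : ℂ) * (β (j + 1) : ℂ) ^ 2) ^ (-(((n : ℂ) - 1) / 2)))
      (∫ w, Complex.exp (Complex.I * (t : ℂ) * (W w : ℂ)) ∂P)) := by
  have hψc : ∀ j, Continuous (ψ j) := fun j => (hψ.smooth j).continuous
  have hψm : ∀ j, Measurable (ψ j) := fun j => (hψc j).measurable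
  have hψ2 : ∀ j, MemLp (ψ j) 2 dv := fun j => by
    obtain ⟨C, hC⟩ := isCompact_univ.exists_bound_of_continuousOn (hψc j).continuousOn
    exact MemLp.of_bound (hψm j).aestronglyMeasurable C
      (Eventually.of_forall fun x => hC x (Set.mem_univ x))
  have hconv := ae_ae_tendsto_partialField hψm hψ2 (fun j => by simp [hψ.orthonormal])
    hβ2 hξm hξ hξi
  have hdist : ∀ w x, fibreDist hf (ofMetric g₀) (g₁ w) x = ‖radialField β ψ ξ w x‖ := fun w x => by
    rw [hg₁, fibreDist_deformedMetric hf _ (sum_radialField_eq_zero w)]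
  set a : ℕ → ℝ := fun j => β (j + 1) ^ 2 with ha
  have ha0 : ∀ j, 0 ≤ a j := fun j => sq_nonneg _
  have has : Summable a := (summable_nat_add_iff (f := fun j => β j ^ 2) 1).2 hβ2
  set U : ℕ → Ω → ℝ := fun j w => ‖(hyperplane n).starProjection (ξ (j + 1) w)‖ ^ 2 with hU
  have hUl : ∀ j, HasLaw (U j) (chiSquared (n - 1)) P := fun j =>
    hasLaw_norm_sq_starProjection_hyperplane hn (hξ (j + 1))
  have hUi : iIndepFun U P := (hξi.precomp (add_left_injective 1)).comp
    (fun _ v => ‖(hyperplane n).starProjection v‖ ^ 2) fun _ => by fun_prop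
  -- Parseval's identity turns `Ω₂²` into the weighted series of the variables `‖π_n (ξ_j)‖²`
  have hpars : ∀ᵐ w ∂P, Integrable (fun x => ‖radialField β ψ ξ w x‖ ^ 2) dv ∧
      ∫ x, ‖radialField β ψ ξ w x‖ ^ 2 ∂dv = ∑' j, a j * U j w := by
    filter_upwards [hconv, ae_summable_mul_chiSquared hUl ha0 has] with w hw hs
    have hnorm : ∀ j, ‖β (j + 1) • (hyperplane n).starProjection (ξ (j + 1) w)‖ ^ 2 =
        a j * U j w := fun j => by
      rw [norm_smul, mul_pow, Real.norm_eq_abs, sq_abs]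
    simp_rw [← hnorm] at hs ⊢
    refine integrable_and_integral_norm_sq_of_orthonormal (fun j => hψ2 (j + 1))
      (fun i j => by simp [hψ.orthonormal]) hs ?_
    filter_upwards [hw] with x hx
    refine hx.congr fun N => ?_
    rw [partialField_eq_sum_range]
    exact Finset.sum_congr rfl fun j _ => by rw [smul_smul, mul_comm]
  have hWU : W =ᵐ[P] fun w => ∑' j, a j * U j w := by
    filter_upwards [hpars] with w hw
    rw [hW, omegaTwoSq]
    simp_rw [hdist]
    exact hw.2
  have hcast : ((n - 1 : ℕ) : ℝ) = n - 1 := by rw [Nat.cast_sub hn, Nat.cast_one]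
  have hcastC : ((n - 1 : ℕ) : ℂ) = n - 1 := by rw [Nat.cast_sub hn, Nat.cast_one]
  refine ⟨hconv, fun w => ?_, ?_, ?_, fun t ht => ?_, fun t => ?_⟩
  · rw [hg₁]
    exact deformedMetric_mem_metDv hg₀ hf _ (sum_radialField_eq_zero w) _
  · filter_upwards [hpars] with w hw
    simp_rw [hdist]
    exact hw.1
  · intro Ω' _ P' _ V hV hVi
    exact ⟨ae_summable_mul_chiSquared hV ha0 has,
      (IdentDistrib.of_ae_eq (aemeasurable_tsum_mul_chiSquared hUl hUi ha0) hWU.symm).symm.trans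
        (identDistrib_tsum_mul_chiSquared hUl hUi hV hVi ha0)⟩
  · have ht' : ∀ j, t * a j < 1 / 2 := fun j => by have := ht j; simp only [ha]; linarith
    have hexp : (fun w => Real.exp (t * W w)) =ᵐ[P] fun w => Real.exp (t * ∑' j, a j * U j w) := by
      filter_upwards [hWU] with w hw
      rw [hw]
    refine ⟨(integrable_congr hexp).2 (integrable_exp_mul_tsum hUl hUi ha0 has ht'), ?_⟩
    have h := hasProd_integral_exp_mul_tsum hUl hUi ha0 has ht'
    rw [mgf, integral_congr_ae hexp]
    simp only [hcast, ← mul_assoc, ha] at h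
    exact h
  · have hexp : (fun w => Complex.exp (Complex.I * (t : ℂ) * (W w : ℂ))) =ᵐ[P]
        fun w => Complex.exp (Complex.I * (t : ℂ) * ((∑' j, a j * U j w : ℝ) : ℂ)) := by
      filter_upwards [hWU] with w hw
      rw [hw]
    have h := hasProd_integral_cexp_mul_tsum hUl hUi ha0 has (z := Complex.I * (t : ℂ))
      (fun j => by simp)
    rw [integral_congr_ae hexp]
    simp only [hcastC, ← mul_assoc, ha, Complex.ofReal_pow] at h
    exact h
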